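/- For each $\beta\in[1,2]$ there is a unique continuous function $\varphi_\beta:[0,\infty)\to\mathbb{R}$ such that for every $x>0$ the function $t\mapsto e^{-xt}\varphi_\beta(t)$ is integrable on $(0,\infty)$ and $$\int_0^\infty e^{-xt}\varphi_\beta(t)\,dt=\frac{1}{1+x^\beta}.$$ Put $\psi_\beta(t)=\int_0^t\varphi_\beta(s)\,ds$ for $t\ge 0$, and let $U$ be the Banach space of bounded, uniformly continuous functions $[0,\infty)\to\mathbb{R}$ with the uniform norm. Then $\psi_\beta\in U$ for $1\le\beta<2$, and the map $\beta\mapsto\psi_\beta$ from $(1,2)$ to $U$ is continuous. Furthermore, as $\beta\to1$ from the right, $$\psi_\beta\to\psi_1\ \text{in } U,\qquad \psi_1(t)=1-e^{-t},$$ and, as $\beta\to2$ from the left, $$\psi_\beta\to\psi_2\ \text{locally uniformly on } [0,\infty),\qquad \psi_2(t)=1-\cos t.$$ -/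

import Mathlib

open Set Filter Topology MeasureTheory
open scoped NNReal BoundedContinuousFunction

noncomputable section

/-- `f` is a continuous function on `[0,∞)` whose Laplace transform is `x ↦ 1 / (1 + x ^ β)`. -/
structure IsLaplaceDensity (β : ℝ) (f : ℝ → ℝ) : Prop where
  continuousOn : ContinuousOn f (Ici 0)
  integrableOn : ∀ x : ℝ, 0 < x → IntegrableOn (fun t => Real.exp (-(x * t)) * f t) (Ioi 0)
  integral_eq : ∀ x : ℝ, 0 < x →
    ∫ t in Ioi (0 : ℝ), Real.exp (-(x * t)) * f t = 1 / (1 + x ^ β)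

/-- The function `φ_β` on `[0,∞)` with Laplace transform `x ↦ 1 / (1 + x ^ β)`.
Only its values on `[0,∞)` are meaningful. -/
def phi (β : ℝ) : ℝ → ℝ := Classical.epsilon (IsLaplaceDensity β)

/-- `ψ_β(t) = ∫_0^t φ_β(s) ds`. -/
def psi (β t : ℝ) : ℝ := ∫ s in (0 : ℝ)..t, phi β s

/-- The space of bounded uniformly continuous real functions on `[0,∞)`, with the uniform norm
(inherited from the bounded continuous functions). -/
def UCB : Submodule ℝ (ℝ≥0 →ᵇ ℝ) where
  carrier := {f | UniformContinuous f}
  add_mem' := fun hf hg => UniformContinuous.add hf hg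
  zero_mem' := uniformContinuous_const
  smul_mem' := fun c _ hf => UniformContinuous.const_smul hf c

/-- `UCB` is a Banach space. -/
instance : CompleteSpace UCB := by
  have h : IsClosed (UCB : Set (ℝ≥0 →ᵇ ℝ)) := by
    refine isClosed_of_closure_subset fun f hf => ?_
    obtain ⟨u, hu, hlim⟩ := mem_closure_iff_seq_limit.1 hf
    exact (BoundedContinuousFunction.tendsto_iff_tendstoUniformly.1 hlim).uniformContinuous
      (Frequently.of_forall hu)
  exact h.completeSpace_coe

end

/-!
The functions are obtained by inverting the Laplace transform along the imaginary axis.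

If `F` is holomorphic on `re z > 0`, continuous up to the boundary, `O(|z|⁻¹)` at infinity and
integrable on the imaginary axis, then `t ↦ (2π)⁻¹ ∫ e^{iξt} F(iξ) dξ` is bounded and continuous, and
by Fubini its Laplace transform at `x > 0` is `(2π)⁻¹ ∫ F(iξ) / (x - iξ) dξ`, which equals `F x` by
Cauchy's formula for the half-plane (`LaplaceInvertible.laplace_axisInv`). Moreover the sup norm of
the inverse transform is at most `(2π)⁻¹ ∫ |F(iξ)| dξ` (`abs_axisInv_le`), so every convergence
statement reduces to `L¹` convergence of symbols on the axis, that is to dominated convergence.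
A continuous function on `[0, ∞)` is determined by its Laplace transform (`eqOn_of_laplace_eq`),
which makes it possible to represent the same function by several symbols.

* For `1 < β < 2` the symbol `1 / (1 + z ^ β)` is invertible in this sense, because `z ^ β` stays in a
  sector avoiding `-1` (`le_norm_one_add_cpow`). It yields `φ_β`, which is bounded. The endpoints are
  `φ_1(t) = e^{-t}` and `φ_2 = sin`.
* For `1 ≤ β < 2`, `ψ_β(t) = 1 - e^{-t} + (inverse transform of S_β)` with
  `S_β(z) = (1 - z ^ (β - 1)) / ((1 + z) (1 + z ^ β))`, and `|S_β(iξ)| ≤ C / (1 + ξ²)` with `C` uniform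
  for `β` in compact subsets of `[1, 2)`. Hence `β ↦ ψ_β` is continuous on `[1, 2)` in the sup norm,
  which covers both the continuity on `(1, 2)` and the limit at `1`.
* As `β → 2` the zeros of `1 + z ^ β` reach the imaginary axis, so the inversion is done on
  `re z = 2` instead: `ψ_β(t) = e^{2t} (inverse transform of 1 / (w (1 + w ^ β)), w = z + 2)`. There
  the symbols are dominated by `2 / (1 + ξ²)` up to `β = 2`, and `e^{2t}` is locally bounded.
-/

/-! ### Uniqueness of Laplace transforms -/

/-- The two measures with densities `(e^{-t} f)⁺` and `(e^{-t} f)⁻` are finite and have complex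
moment generating functions that are analytic on `re z < 1` and agree on the real axis there,
hence on the imaginary axis; so their characteristic functions agree. -/
theorem eqOn_zero_of_laplace_eq_zero {f : ℝ → ℝ} (hf : ContinuousOn f (Ici 0))
    (hi : ∀ x : ℝ, 0 < x → IntegrableOn (fun t => Real.exp (-(x * t)) * f t) (Ioi 0))
    (h0 : ∀ x : ℝ, 0 < x → ∫ t in Ioi (0 : ℝ), Real.exp (-(x * t)) * f t = 0) :
    EqOn f 0 (Ici 0) := by
  set ν : Measure ℝ := volume.restrict (Ioi 0) with hν
  set g : ℝ → ℝ := fun t => Real.exp (-(1 * t)) * f t with hg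
  have hgi : Integrable g ν := hi 1 one_pos
  let D : (ℝ → ℝ) → Measure ℝ := fun h => ν.withDensity fun t => ENNReal.ofReal (h t)
  have hmeas : ∀ h : ℝ → ℝ, Integrable h ν → AEMeasurable (fun t => ENNReal.ofReal (h t)) ν :=
    fun h hh => hh.1.aemeasurable.ennreal_ofReal
  have hfin : ∀ h : ℝ → ℝ, Integrable h ν → IsFiniteMeasure (D h) := by
    intro h hh
    exact isFiniteMeasure_withDensity_ofReal hh.2
  have hfint : ∀ h : ℝ → ℝ, ∀ᵐ t ∂ν, ENNReal.ofReal (h t) < ⊤ :=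
    fun h => ae_of_all _ fun t => ENNReal.ofReal_lt_top
  have hexp : ∀ s : ℝ, s < 1 → Integrable (fun t => Real.exp (s * t) * g t) ν := by
    intro s hs
    refine (hi (1 - s) (by linarith)).congr (ae_of_all _ fun t => ?_)
    simp only [hg, ← mul_assoc, ← Real.exp_add]
    congr 2; ring
  have hnegexp : ∀ s : ℝ, s < 1 → Integrable (fun t => Real.exp (s * t) * (-g) t) ν := by
    intro s hs
    refine (hexp s hs).neg.congr (ae_of_all _ fun t => ?_)
    simp
  have hpos : ∀ h : ℝ → ℝ, (∀ s : ℝ, s < 1 → Integrable (fun t => Real.exp (s * t) * h t) ν) →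
      ∀ s : ℝ, s < 1 → Integrable (fun t => (h t)⁺ * Real.exp (s * t)) ν := by
    intro h hh s hs
    refine (hh s hs).pos_part.congr (ae_of_all _ fun t => ?_)
    simp only [posPart_def]
    rw [max_mul_of_nonneg _ _ (Real.exp_pos _).le, zero_mul, mul_comm]
  have htoReal : ∀ y : ℝ, (ENNReal.ofReal y).toReal = y⁺ := by
    intro y; simp [ENNReal.toReal_ofReal', posPart_def]
  have hset : ∀ h : ℝ → ℝ, Integrable h ν →
      (∀ s : ℝ, s < 1 → Integrable (fun t => Real.exp (s * t) * h t) ν) →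
      Iio 1 ⊆ ProbabilityTheory.integrableExpSet id (D h) := by
    intro h hhi hh s hs
    change Integrable _ (ν.withDensity _)
    rw [integrable_withDensity_iff_integrable_smul₀' (hmeas h hhi) (hfint h)]
    simpa only [smul_eq_mul, htoReal, id] using hpos h hh s hs
  have hmgf : ∀ h : ℝ → ℝ, Integrable h ν → ∀ s : ℝ,
      ProbabilityTheory.mgf id (D h) s = ∫ t, (h t)⁺ * Real.exp (s * t) ∂ν := by
    intro h hhi s
    change ∫ t, Real.exp (s * t) ∂(ν.withDensity _) = _
    rw [integral_withDensity_eq_integral_toReal_smul₀ (hmeas h hhi) (hfint h)]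
    simp only [smul_eq_mul, htoReal]
  have heq : ∀ s : ℝ, s < 1 →
      ProbabilityTheory.mgf id (D g) s = ProbabilityTheory.mgf id (D (-g)) s := by
    intro s hs
    rw [hmgf g hgi, hmgf (-g) hgi.neg, ← sub_eq_zero,
      ← integral_sub (hpos g hexp s hs) (hpos (-g) hnegexp s hs), ← h0 (1 - s) (by linarith)]
    refine integral_congr_ae (ae_of_all _ fun t => ?_)
    have : (g t)⁺ - (-g t)⁺ = g t := by
      rw [posPart_neg]; exact posPart_sub_negPart _
    simp only [Pi.neg_apply, ← sub_mul, this]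
    simp only [hg]
    rw [mul_right_comm, ← Real.exp_add]
    congr 2; ring
  have hsub : ∀ h : ℝ → ℝ, Integrable h ν →
      (∀ s : ℝ, s < 1 → Integrable (fun t => Real.exp (s * t) * h t) ν) →
      AnalyticOnNhd ℂ (ProbabilityTheory.complexMGF id (D h)) {z | z.re < 1} := by
    intro h hhi hh
    refine ProbabilityTheory.analyticOnNhd_complexMGF.mono fun z hz => ?_
    exact interior_mono (hset h hhi hh) (by rw [interior_Iio]; exact hz)
  have hU : IsPreconnected {z : ℂ | z.re < 1} :=
    (convex_halfSpace_re_lt 1).isPreconnected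
  have hcm : EqOn (ProbabilityTheory.complexMGF id (D g))
      (ProbabilityTheory.complexMGF id (D (-g))) {z | z.re < 1} := by
    refine (hsub g hgi hexp).eqOn_of_preconnected_of_frequently_eq
      (hsub (-g) hgi.neg hnegexp) hU (z₀ := 0) (by simp) ?_
    have hT : Tendsto (fun s : ℝ => (s : ℂ)) (𝓝[≠] 0) (𝓝[≠] 0) := by
      refine tendsto_nhdsWithin_iff.2 ⟨?_, ?_⟩
      · exact (Complex.continuous_ofReal.tendsto' 0 0 (by simp)).mono_left nhdsWithin_le_nhds
      · filter_upwards [self_mem_nhdsWithin] with s hs using by simpa using hs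
    refine hT.frequently (Eventually.frequently ?_)
    have : Iio (1 : ℝ) ∈ 𝓝[≠] (0 : ℝ) := mem_nhdsWithin_of_mem_nhds (Iio_mem_nhds one_pos)
    filter_upwards [this] with s hs
    rw [ProbabilityTheory.complexMGF_ofReal, ProbabilityTheory.complexMGF_ofReal, heq s hs]
  have := hfin g hgi
  have := hfin (-g) hgi.neg
  have hD : D g = D (-g) := by
    refine Measure.ext_of_charFun (funext fun t => ?_)
    rw [← ProbabilityTheory.complexMGF_id_mul_I, ← ProbabilityTheory.complexMGF_id_mul_I]
    exact hcm (by simp)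
  have hae : f =ᵐ[ν] 0 := by
    have h1 := (withDensity_eq_iff (hmeas g hgi) (hmeas (-g) hgi.neg) ?_).1 hD
    · filter_upwards [h1] with t ht
      have ht2 := congrArg ENNReal.toReal ht
      rw [htoReal, htoReal] at ht2
      have h3 : g t = 0 := by
        rw [← posPart_sub_negPart (g t), ← posPart_neg, ht2]; simp
      simpa [hg] using h3
    · have := (hfin g hgi).measure_univ_lt_top.ne
      simpa [D] using this
  have hIoi : EqOn f 0 (Ioi 0) :=
    Measure.eqOn_open_of_ae_eq hae isOpen_Ioi (hf.mono Ioi_subset_Ici_self) continuousOn_const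
  refine EqOn.of_subset_closure hIoi hf continuousOn_const Ioi_subset_Ici_self ?_
  rw [closure_Ioi]

theorem eqOn_of_laplace_eq {f g : ℝ → ℝ} (hf : ContinuousOn f (Ici 0)) (hg : ContinuousOn g (Ici 0))
    (hfi : ∀ x : ℝ, 0 < x → IntegrableOn (fun t => Real.exp (-(x * t)) * f t) (Ioi 0))
    (hgi : ∀ x : ℝ, 0 < x → IntegrableOn (fun t => Real.exp (-(x * t)) * g t) (Ioi 0))
    (h : ∀ x : ℝ, 0 < x → ∫ t in Ioi (0 : ℝ), Real.exp (-(x * t)) * f t =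
      ∫ t in Ioi (0 : ℝ), Real.exp (-(x * t)) * g t) :
    EqOn f g (Ici 0) := by
  have h1 := eqOn_zero_of_laplace_eq_zero (f := fun t => f t - g t) (hf.sub hg)
    (fun x hx => ((hfi x hx).sub (hgi x hx)).congr (ae_of_all _ fun t => by simp [mul_sub]))
    (fun x hx => by
      simp only [mul_sub]
      rw [integral_sub (hfi x hx) (hgi x hx), h x hx, sub_self])
  intro t ht
  simpa [sub_eq_zero] using h1 ht

/-! ### Laplace inversion on the imaginary axis -/

/-- If `Q` is holomorphic on the right half-plane, continuous up to the boundary and `O(|z|⁻²)` at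
infinity, its integral along the imaginary axis vanishes: Cauchy's theorem on the rectangles
`[0, R] × [-R, R]`. -/
theorem integral_imaginaryAxis_eq_zero {Q : ℂ → ℂ} {C R₀ : ℝ}
    (hc : ContinuousOn Q {z | 0 ≤ z.re}) (hd : DifferentiableOn ℂ Q {z | 0 < z.re})
    (hb : ∀ z : ℂ, 0 ≤ z.re → R₀ ≤ ‖z‖ → ‖Q z‖ ≤ C / ‖z‖ ^ 2)
    (hi : Integrable fun ξ : ℝ => Q (ξ * Complex.I)) :
    ∫ ξ : ℝ, Q (ξ * Complex.I) = 0 := by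
  have hlim := intervalIntegral_tendsto_integral hi tendsto_neg_atTop_atBot tendsto_id
  refine tendsto_nhds_unique hlim ?_
  rw [tendsto_zero_iff_norm_tendsto_zero]
  have hC : Tendsto (fun R : ℝ => 4 * C * R⁻¹) atTop (𝓝 0) := by
    simpa using tendsto_inv_atTop_zero.const_mul (4 * C)
  refine squeeze_zero' (Eventually.of_forall fun _ => norm_nonneg _) ?_ hC
  filter_upwards [eventually_ge_atTop R₀, eventually_gt_atTop 0] with R hR0 hR
  have hrect := Complex.integral_boundary_rect_eq_zero_of_continuousOn_of_differentiableOn Q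
    ((-R : ℝ) * Complex.I) (R + R * Complex.I)
    (hc.mono fun z hz => by
      have := hz.1
      simp [uIcc_of_le hR.le] at this
      exact this.1)
    (hd.mono fun z hz => by
      have := hz.1
      simp [min_eq_left hR.le] at this
      exact this.1)
  simp only [Complex.mul_re, Complex.ofReal_re, Complex.I_re, mul_zero, Complex.ofReal_im,
    Complex.I_im, mul_one, sub_self, Complex.add_re, add_zero, Complex.mul_im, Complex.add_im,
    zero_add, Complex.ofReal_zero, smul_eq_mul] at hrect
  have hC0 : 0 ≤ C / R ^ 2 := by
    have := (norm_nonneg _).trans (hb (R : ℂ) (by simpa using hR.le) (by simpa [abs_of_pos hR]))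
    simpa [abs_of_pos hR] using this
  have hC0' : 0 ≤ C := by
    by_contra! h
    exact absurd hC0 (not_le.2 (div_neg_of_neg_of_pos h (by positivity)))
  have key : ∀ z : ℂ, 0 ≤ z.re → R ≤ ‖z‖ → ‖Q z‖ ≤ C / R ^ 2 := fun z hz hzR =>
    (hb z hz (hR0.trans hzR)).trans (by gcongr)
  have hbot : ‖∫ x : ℝ in (0 : ℝ)..R, Q (x + (-R : ℝ) * Complex.I)‖ ≤ C / R ^ 2 * |R - 0| := by
    refine intervalIntegral.norm_integral_le_of_norm_le_const fun x hx => ?_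
    rw [uIoc_of_le hR.le] at hx
    refine key _ (by simpa using hx.1.le) ?_
    have := Complex.abs_im_le_norm (x + (-R : ℝ) * Complex.I)
    simpa [abs_of_pos hR] using this
  have htop : ‖∫ x : ℝ in (0 : ℝ)..R, Q (x + R * Complex.I)‖ ≤ C / R ^ 2 * |R - 0| := by
    refine intervalIntegral.norm_integral_le_of_norm_le_const fun x hx => ?_
    rw [uIoc_of_le hR.le] at hx
    refine key _ (by simpa using hx.1.le) ?_
    have := Complex.abs_im_le_norm (x + R * Complex.I)
    simpa [abs_of_pos hR] using this
  have hright : ‖∫ y : ℝ in (-R)..R, Q (R + y * Complex.I)‖ ≤ C / R ^ 2 * |R - (-R)| := by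
    refine intervalIntegral.norm_integral_le_of_norm_le_const fun y _ => ?_
    refine key _ (by simpa using hR.le) ?_
    have := Complex.abs_re_le_norm (R + y * Complex.I)
    simpa [abs_of_pos hR] using this
  set A := ∫ x : ℝ in (0 : ℝ)..R, Q (x + (-R : ℝ) * Complex.I)
  set B := ∫ x : ℝ in (0 : ℝ)..R, Q (x + R * Complex.I)
  set E := ∫ y : ℝ in (-R)..R, Q (R + y * Complex.I)
  have hJ : Complex.I * (∫ y : ℝ in (-R)..R, Q (y * Complex.I)) = A - B + Complex.I * E := by
    linear_combination -hrect
  have hJn : ‖∫ y : ℝ in (-R)..R, Q (y * Complex.I)‖ ≤ ‖A‖ + ‖B‖ + ‖E‖ := by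
    have := congrArg norm hJ
    rw [norm_mul, Complex.norm_I, one_mul] at this
    rw [this]
    refine (norm_add_le _ _).trans ?_
    rw [norm_mul, Complex.norm_I, one_mul]
    gcongr
    exact norm_sub_le _ _
  rw [sub_zero, abs_of_pos hR] at hbot htop
  rw [sub_neg_eq_add, abs_of_pos (by linarith)] at hright
  refine hJn.trans ?_
  have : C / R ^ 2 * R + C / R ^ 2 * R + C / R ^ 2 * (R + R) = 4 * C * R⁻¹ := by
    field_simp; ring
  linarith

/-- Functions on the closed right half-plane to which Laplace inversion along the imaginary axis
applies: holomorphic inside, continuous up to the boundary, `O(|z|⁻¹)` at infinity, and integrable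
on the boundary. -/
structure LaplaceInvertible (F : ℂ → ℂ) : Prop where
  continuousOn : ContinuousOn F {z | 0 ≤ z.re}
  differentiableOn : DifferentiableOn ℂ F {z | 0 < z.re}
  decay : ∃ C R : ℝ, ∀ z : ℂ, 0 ≤ z.re → R ≤ ‖z‖ → ‖F z‖ ≤ C / ‖z‖
  integrable : Integrable fun ξ : ℝ => F (ξ * Complex.I)

theorem integral_poisson_kernel {x : ℝ} (hx : 0 < x) :
    Integrable (fun ξ : ℝ => 2 * x / (x ^ 2 + ξ ^ 2)) ∧
      ∫ ξ : ℝ, 2 * x / (x ^ 2 + ξ ^ 2) = 2 * Real.pi := by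
  have h : (fun ξ : ℝ => 2 * x / (x ^ 2 + ξ ^ 2)) =
      fun ξ : ℝ => 2 / x * (1 + (ξ / x) ^ 2)⁻¹ := by
    ext ξ
    have : x ^ 2 + ξ ^ 2 ≠ 0 := by positivity
    field_simp
  rw [h]
  refine ⟨(integrable_inv_one_add_sq.comp_div hx.ne').const_mul _, ?_⟩
  rw [integral_const_mul, Measure.integral_comp_div (fun y : ℝ => (1 + y ^ 2)⁻¹),
    integral_univ_inv_one_add_sq, abs_of_pos hx, smul_eq_mul]
  field_simp

theorem norm_le_norm_add_of_re_nonneg {z : ℂ} {x : ℝ} (hz : 0 ≤ z.re) (hx : 0 < x) :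
    ‖z‖ ≤ ‖z + x‖ := by
  rw [Complex.norm_def, Complex.norm_def]
  apply Real.sqrt_le_sqrt
  simp [Complex.normSq_apply]
  nlinarith

/-- Cauchy's integral formula for the right half-plane, at a point of the real axis. -/
theorem LaplaceInvertible.integral_div_sub {F : ℂ → ℂ} (hF : LaplaceInvertible F) {x : ℝ}
    (hx : 0 < x) :
    Integrable (fun ξ : ℝ => F (ξ * Complex.I) / (x - ξ * Complex.I)) ∧
      ∫ ξ : ℝ, F (ξ * Complex.I) / (x - ξ * Complex.I) = 2 * Real.pi * F x := by
  have hne : ∀ ξ : ℝ, (x : ℂ) - ξ * Complex.I ≠ 0 := fun ξ h => by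
    have := congrArg Complex.re h
    simp at this; exact hx.ne' this
  have hne' : ∀ ξ : ℝ, (ξ * Complex.I : ℂ) + x ≠ 0 := fun ξ h => by
    have := congrArg Complex.re h
    simp at this; exact hx.ne' this
  have hI1 : Integrable (fun ξ : ℝ => F (ξ * Complex.I) / (x - ξ * Complex.I)) := by
    simp only [div_eq_mul_inv]
    refine hF.integrable.mul_bdd (c := x⁻¹) ?_ (ae_of_all _ fun ξ => ?_)
    · exact (Continuous.inv₀ (by fun_prop) hne).aestronglyMeasurable
    · rw [norm_inv]
      have := Complex.abs_re_le_norm ((x : ℂ) - ξ * Complex.I)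
      simp [abs_of_pos hx] at this
      gcongr
  refine ⟨hI1, ?_⟩
  -- Subtracting this multiple of `2x / (z + x)` makes the numerator vanish at `x` without losing
  -- the decay at infinity; the correction produces the Poisson kernel on the axis.
  set H : ℂ → ℂ := fun z => F z - F x * (2 * x / (z + x)) with hH
  have hHx : H x = 0 := by
    have : (x : ℂ) ≠ 0 := by exact_mod_cast hx.ne'
    simp only [hH]
    field_simp
    ring
  have hden : ∀ z : ℂ, 0 ≤ z.re → z + x ≠ 0 := fun z hz h => by
    have := congrArg Complex.re h
    simp at this; linarith
  have hHc : ContinuousOn H {z | 0 ≤ z.re} :=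
    hF.continuousOn.sub (continuousOn_const.mul
      (continuousOn_const.div (by fun_prop) fun z hz => hden z hz))
  have hHd : DifferentiableOn ℂ H {z | 0 < z.re} :=
    hF.differentiableOn.sub ((differentiableOn_const _).mul
      ((differentiableOn_const _).div (by fun_prop) fun z hz => hden z (le_of_lt hz)))
  have hopen : {z : ℂ | 0 < z.re} ∈ 𝓝 (x : ℂ) :=
    (isOpen_lt continuous_const Complex.continuous_re).mem_nhds (by simpa using hx)
  have hQc : ContinuousOn (dslope H x) {z | 0 ≤ z.re} :=
    (continuousOn_dslope (mem_of_superset hopen fun z (hz : 0 < z.re) => hz.le)).2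
      ⟨hHc, hHd.differentiableAt hopen⟩
  have hQd : DifferentiableOn ℂ (dslope H x) {z | 0 < z.re} :=
    (Complex.differentiableOn_dslope hopen).2 hHd
  have hQ : ∀ z : ℂ, z ≠ x → dslope H x z = H z / (z - x) := fun z hz => by
    rw [dslope_of_ne _ hz, slope_def_field, hHx, sub_zero]
  have hQaxis : ∀ ξ : ℝ, dslope H x (ξ * Complex.I) =
      F x * (2 * x / (x ^ 2 + ξ ^ 2) : ℝ) - F (ξ * Complex.I) / (x - ξ * Complex.I) := by
    intro ξ
    have h1 : (ξ * Complex.I : ℂ) ≠ x := fun h => hne ξ (by rw [h, sub_self])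
    rw [hQ _ h1, hH]
    have h2 := hne ξ
    have h3 := hne' ξ
    have h4 : (ξ * Complex.I : ℂ) - x ≠ 0 := sub_ne_zero.2 h1
    have h5 : ((x ^ 2 + ξ ^ 2 : ℝ) : ℂ) = (x - ξ * Complex.I) * (ξ * Complex.I + x) := by
      push_cast; ring_nf; simp
    push_cast at h5
    push_cast
    rw [h5]
    have h6 : (ξ * Complex.I : ℂ) - x = -(x - ξ * Complex.I) := by ring
    rw [h6]
    field_simp
    ring
  obtain ⟨hP1, hP2⟩ := integral_poisson_kernel hx
  have hPI : Integrable fun ξ : ℝ => F x * ((2 * x / (x ^ 2 + ξ ^ 2) : ℝ) : ℂ) :=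
    hP1.ofReal.const_mul _
  obtain ⟨C, R, hCR⟩ := hF.decay
  have h0 := integral_imaginaryAxis_eq_zero (Q := dslope H x) (C := 2 * (C + ‖F x‖ * (2 * x)))
    (R₀ := max R (2 * x)) hQc hQd ?_ ?_
  · simp only [hQaxis] at h0
    rw [integral_sub hPI hI1, sub_eq_zero] at h0
    rw [← h0, integral_const_mul, integral_complex_ofReal, hP2]
    push_cast; ring
  · intro z hz hzR
    have hR := (le_max_left _ _).trans hzR
    have h2x := (le_max_right _ _).trans hzR
    have hz0 : 0 < ‖z‖ := by linarith
    have hzx : ‖z‖ / 2 ≤ ‖z - x‖ := by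
      have := norm_sub_norm_le z (x : ℂ)
      rw [Complex.norm_real, Real.norm_of_nonneg hx.le] at this
      linarith
    have hne : z ≠ x := by
      rintro rfl
      rw [sub_self, norm_zero] at hzx
      linarith
    rw [hQ z hne, norm_div]
    have hH1 : ‖H z‖ ≤ (C + ‖F x‖ * (2 * x)) / ‖z‖ := by
      refine (norm_sub_le _ _).trans ?_
      rw [add_div]
      refine add_le_add (hCR z hz hR) ?_
      rw [norm_mul, norm_div, mul_div_assoc]
      gcongr
      · simp [abs_of_pos hx]
      · exact norm_le_norm_add_of_re_nonneg hz hx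
    calc ‖H z‖ / ‖z - x‖ ≤ ((C + ‖F x‖ * (2 * x)) / ‖z‖) / (‖z‖ / 2) :=
          div_le_div₀ ((norm_nonneg _).trans hH1) hH1 (by positivity) hzx
      _ = _ := by field_simp
  · simp only [hQaxis]
    exact hPI.sub hI1

/-- The inverse Laplace transform of `F`, computed along the imaginary axis:
`(2π)⁻¹ ∫ e^{iξt} F(iξ) dξ`. The real part is taken so as to have a real-valued function; it is
harmless for the functions `F` below, which are real on the real axis. -/
noncomputable def axisInv (F : ℂ → ℂ) (t : ℝ) : ℝ :=
  (2 * Real.pi)⁻¹ * (∫ ξ : ℝ, Complex.exp (t * ξ * Complex.I) * F (ξ * Complex.I)).re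

theorem norm_exp_mul_I_mul (t ξ : ℝ) (w : ℂ) :
    ‖Complex.exp (t * ξ * Complex.I) * w‖ = ‖w‖ := by
  rw [norm_mul, ← Complex.ofReal_mul, Complex.norm_exp_ofReal_mul_I, one_mul]

theorem integrable_exp_mul {F : ℂ → ℂ} (hF : Integrable fun ξ : ℝ => F (ξ * Complex.I)) (t : ℝ) :
    Integrable fun ξ : ℝ => Complex.exp (t * ξ * Complex.I) * F (ξ * Complex.I) := by
  refine hF.mono ?_ (ae_of_all _ fun ξ => (norm_exp_mul_I_mul t ξ _).le)
  exact (Continuous.aestronglyMeasurable (by fun_prop)).mul hF.1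

theorem abs_axisInv_le (F : ℂ → ℂ) (t : ℝ) :
    |axisInv F t| ≤ (2 * Real.pi)⁻¹ * ∫ ξ : ℝ, ‖F (ξ * Complex.I)‖ := by
  rw [axisInv, abs_mul, abs_of_pos (by positivity)]
  gcongr
  refine (Complex.abs_re_le_norm _).trans ((norm_integral_le_integral_norm _).trans_eq ?_)
  simp only [norm_exp_mul_I_mul]

theorem axisInv_sub {F G : ℂ → ℂ} (hF : Integrable fun ξ : ℝ => F (ξ * Complex.I))
    (hG : Integrable fun ξ : ℝ => G (ξ * Complex.I)) (t : ℝ) :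
    axisInv F t - axisInv G t = axisInv (fun z => F z - G z) t := by
  simp only [axisInv, mul_sub]
  rw [integral_sub (integrable_exp_mul hF t) (integrable_exp_mul hG t), Complex.sub_re, mul_sub]

theorem continuous_axisInv {F : ℂ → ℂ} (hF : Integrable fun ξ : ℝ => F (ξ * Complex.I)) :
    Continuous (axisInv F) := by
  refine continuous_const.mul (Complex.continuous_re.comp ?_)
  refine continuous_of_dominated (bound := fun ξ : ℝ => ‖F (ξ * Complex.I)‖)
    (fun t => (integrable_exp_mul hF t).1)
    (fun t => ae_of_all _ fun ξ => (norm_exp_mul_I_mul t ξ _).le) hF.norm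
    (ae_of_all _ fun ξ => by fun_prop)

theorem LaplaceInvertible.laplace_axisInv {F : ℂ → ℂ} (hF : LaplaceInvertible F) {x : ℝ}
    (hx : 0 < x) :
    IntegrableOn (fun t => Real.exp (-(x * t)) * axisInv F t) (Ioi 0) ∧
      ∫ t in Ioi (0 : ℝ), Real.exp (-(x * t)) * axisInv F t = (F x).re := by
  have hE : IntegrableOn (fun t : ℝ => Real.exp (-(x * t))) (Ioi 0) := by
    simpa only [neg_mul] using exp_neg_integrableOn_Ioi 0 hx
  have hprod : Integrable (Function.uncurry fun (t ξ : ℝ) => ((Real.exp (-(x * t)) : ℝ) : ℂ) *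
      (Complex.exp (t * ξ * Complex.I) * F (ξ * Complex.I)))
      ((volume.restrict (Ioi 0)).prod volume) := by
    have h1 : Integrable (fun p : ℝ × ℝ => ((Real.exp (-(x * p.1)) : ℝ) : ℂ) *
        F (p.2 * Complex.I)) ((volume.restrict (Ioi 0)).prod volume) :=
      Integrable.mul_prod (Integrable.ofReal (𝕜 := ℂ) hE) hF.integrable
    have hm : AEStronglyMeasurable (fun p : ℝ × ℝ => Complex.exp (p.1 * p.2 * Complex.I))
      ((volume.restrict (Ioi 0)).prod volume) :=
      Continuous.aestronglyMeasurable (by fun_prop)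
    refine (h1.bdd_mul (c := 1) hm (ae_of_all _ fun p => ?_)).congr (ae_of_all _ fun p => ?_)
    · rw [← Complex.ofReal_mul, Complex.norm_exp_ofReal_mul_I]
    · simp only [Function.uncurry]
      ring
  have hint : Integrable (fun t : ℝ => ∫ ξ : ℝ, ((Real.exp (-(x * t)) : ℝ) : ℂ) *
      (Complex.exp (t * ξ * Complex.I) * F (ξ * Complex.I))) (volume.restrict (Ioi 0)) :=
    hprod.integral_prod_left
  have hre : ∀ t : ℝ, Real.exp (-(x * t)) * axisInv F t =
      (2 * Real.pi)⁻¹ * (∫ ξ : ℝ, ((Real.exp (-(x * t)) : ℝ) : ℂ) *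
        (Complex.exp (t * ξ * Complex.I) * F (ξ * Complex.I))).re := by
    intro t
    rw [integral_const_mul, Complex.re_ofReal_mul, axisInv]
    ring
  simp only [hre]
  refine ⟨hint.re.const_mul _, ?_⟩
  rw [integral_const_mul]
  have h1 := integral_re hint
  simp only [RCLike.re_eq_complex_re] at h1
  rw [h1, integral_integral_swap hprod]
  have h2 : ∀ ξ : ℝ, ∫ t in Ioi (0 : ℝ), ((Real.exp (-(x * t)) : ℝ) : ℂ) *
      (Complex.exp (t * ξ * Complex.I) * F (ξ * Complex.I)) =
      F (ξ * Complex.I) / (x - ξ * Complex.I) := by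
    intro ξ
    have h3 : ∀ t : ℝ, ((Real.exp (-(x * t)) : ℝ) : ℂ) *
      (Complex.exp (t * ξ * Complex.I) * F (ξ * Complex.I)) =
      Complex.exp ((-x + ξ * Complex.I) * t) * F (ξ * Complex.I) := by
      intro t
      push_cast
      rw [← mul_assoc, ← Complex.exp_add]
      congr 2
      ring
    simp only [h3]
    rw [integral_mul_const, integral_exp_mul_complex_Ioi (by simpa using hx)]
    have h4 : -(x : ℂ) + ξ * Complex.I = -(x - ξ * Complex.I) := by ring
    rw [h4, Complex.ofReal_zero, mul_zero, Complex.exp_zero, neg_div_neg_eq, div_mul_eq_mul_div,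
      one_mul]
  simp only [h2]
  rw [(hF.integral_div_sub hx).2]
  have : (2 * Real.pi * F x : ℂ) = ((2 * Real.pi : ℝ) : ℂ) * F x := by push_cast; ring
  rw [this, Complex.re_ofReal_mul]
  field_simp

/-! ### The symbols -/

theorem cos_mul_pi_div_four_pos {β : ℝ} (h0 : 0 ≤ β) (h2 : β < 2) :
    0 < Real.cos (β * Real.pi / 4) := by
  have := Real.pi_pos
  exact Real.cos_pos_of_mem_Ioo ⟨by nlinarith, by nlinarith⟩

/-- On the closed right half-plane `z ^ β` stays in the sector `|arg| ≤ βπ/2`, which for `β < 2`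
avoids `-1`. -/
theorem le_norm_one_add_cpow {β : ℝ} (h0 : 0 < β) (h2 : β ≤ 2) {z : ℂ} (hz : 0 ≤ z.re) :
    Real.cos (β * Real.pi / 4) * (1 + ‖z‖ ^ β) ≤ ‖1 + z ^ (β : ℂ)‖ := by
  have hpi := Real.pi_pos
  set c := Real.cos (β * Real.pi / 4) with hc
  set ρ := ‖z‖ ^ β with hρ
  have hρ0 : 0 ≤ ρ := Real.rpow_nonneg (norm_nonneg _) _
  have hnorm : ‖z ^ (β : ℂ)‖ = ρ := Complex.norm_cpow_real z β
  have hre : (z ^ (β : ℂ)).re = ρ * Real.cos (z.arg * β) := Complex.cpow_ofReal_re z β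
  have harg : |z.arg| ≤ Real.pi / 2 := Complex.abs_arg_le_pi_div_two_iff.2 hz
  have hcos : 2 * c ^ 2 - 1 ≤ Real.cos (z.arg * β) := by
    rw [hc, ← Real.cos_two_mul, ← Real.cos_abs (z.arg * β)]
    refine Real.cos_le_cos_of_nonneg_of_le_pi (abs_nonneg _) (by nlinarith) ?_
    rw [abs_mul, abs_of_pos h0]
    nlinarith
  have hc1 : c ^ 2 ≤ 1 := Real.cos_sq_le_one _
  have hsq : ‖1 + z ^ (β : ℂ)‖ ^ 2 = 1 + 2 * (z ^ (β : ℂ)).re + ρ ^ 2 := by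
    rw [← hnorm, Complex.sq_norm, Complex.sq_norm, Complex.normSq_add]
    simp
    ring
  refine (abs_le_of_sq_le_sq' ?_ (norm_nonneg _)).2
  rw [hsq, hre]
  nlinarith [mul_le_mul_of_nonneg_left hcos hρ0, mul_nonneg (sub_nonneg.2 hc1) (sq_nonneg (1 - ρ))]

theorem one_add_cpow_ne_zero {β : ℝ} (h0 : 0 < β) (h2 : β < 2) {z : ℂ} (hz : 0 ≤ z.re) :
    1 + z ^ (β : ℂ) ≠ 0 := by
  have h1 := le_norm_one_add_cpow h0 h2.le hz
  have h3 := cos_mul_pi_div_four_pos h0.le h2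
  have : 0 ≤ ‖z‖ ^ β := Real.rpow_nonneg (norm_nonneg _) _
  exact norm_pos_iff.1 (lt_of_lt_of_le (by positivity) h1)

theorem one_add_ne_zero_of_re {z : ℂ} (hz : 0 ≤ z.re) : 1 + z ≠ 0 := fun h => by
  have := congrArg Complex.re h
  simp at this; linarith

theorem continuousOn_cpow_rightHalfPlane {β : ℝ} (h0 : 0 < β) :
    ContinuousOn (fun z : ℂ => z ^ (β : ℂ)) {z | 0 ≤ z.re} := fun _ hz =>
  (Complex.continuousAt_cpow_const_of_re_pos (Or.inl hz) (by simpa using h0)).continuousWithinAt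

theorem differentiableOn_cpow_rightHalfPlane (β : ℝ) :
    DifferentiableOn ℂ (fun z : ℂ => z ^ (β : ℂ)) {z | 0 < z.re} := fun _ hz =>
  (differentiableAt_id.cpow (differentiableAt_const _)
    (Complex.mem_slitPlane_iff.2 (Or.inl hz))).differentiableWithinAt

/-- The Laplace transform `1 / (1 + z ^ β)` of `φ_β`. -/
noncomputable def phiSymbol (β : ℝ) (z : ℂ) : ℂ := 1 / (1 + z ^ (β : ℂ))

/-- The Laplace transform of `ψ_β - ψ_1`, that is `1 / (z (1 + z ^ β)) - 1 / (z (1 + z))`, with the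
factor `z⁻¹` cancelled so that it is continuous on the closed right half-plane. -/
noncomputable def psiSymbol (β : ℝ) (z : ℂ) : ℂ :=
  (1 - z ^ ((β - 1 : ℝ) : ℂ)) / ((1 + z) * (1 + z ^ (β : ℂ)))

/-- The Laplace transform of `e^{-2t} ψ_β(t)`. -/
noncomputable def shiftedSymbol (β : ℝ) (z : ℂ) : ℂ :=
  1 / ((z + 2) * (1 + (z + 2) ^ (β : ℂ)))

theorem norm_phiSymbol_le {β : ℝ} (h1 : 1 ≤ β) (h2 : β < 2) {z : ℂ} (hz : 0 ≤ z.re) :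
    ‖phiSymbol β z‖ ≤ 1 / (Real.cos (β * Real.pi / 4) * (1 + ‖z‖ ^ β)) := by
  have hc := cos_mul_pi_div_four_pos (by linarith) h2
  have : 0 ≤ ‖z‖ ^ β := Real.rpow_nonneg (norm_nonneg _) _
  rw [phiSymbol, norm_div, norm_one]
  exact one_div_le_one_div_of_le (by positivity) (le_norm_one_add_cpow (by linarith) h2.le hz)

theorem one_add_rpow_le {r β : ℝ} (hr : 0 ≤ r) (hβ : 0 ≤ β) :
    (1 + r) ^ β ≤ 2 ^ β * (1 + r ^ β) := by
  have hrβ : 0 ≤ r ^ β := Real.rpow_nonneg hr _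
  have h2 : (0 : ℝ) ≤ 2 ^ β := by positivity
  rcases le_total r 1 with h | h
  · calc (1 + r) ^ β ≤ 2 ^ β := Real.rpow_le_rpow (by linarith) (by linarith) hβ
      _ ≤ _ := le_mul_of_one_le_right h2 (by linarith)
  · calc (1 + r) ^ β ≤ (2 * r) ^ β := Real.rpow_le_rpow (by linarith) (by linarith) hβ
      _ = 2 ^ β * r ^ β := Real.mul_rpow (by norm_num) hr
      _ ≤ _ := by gcongr; linarith

theorem laplaceInvertible_phiSymbol {β : ℝ} (h1 : 1 < β) (h2 : β < 2) :
    LaplaceInvertible (phiSymbol β) := by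
  have hβ : 0 < β := by linarith
  have hc := cos_mul_pi_div_four_pos hβ.le h2
  have hcont : ContinuousOn (phiSymbol β) {z | 0 ≤ z.re} :=
    continuousOn_const.div (continuousOn_const.add (continuousOn_cpow_rightHalfPlane hβ))
      fun z hz => one_add_cpow_ne_zero hβ h2 hz
  refine ⟨hcont, ?_, ⟨1 / Real.cos (β * Real.pi / 4), 1, fun z hz hz1 => ?_⟩, ?_⟩
  · exact (differentiableOn_const _).div
      ((differentiableOn_const _).add (differentiableOn_cpow_rightHalfPlane β))
      fun z hz => one_add_cpow_ne_zero hβ h2 (le_of_lt hz)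
  · refine (norm_phiSymbol_le h1.le h2 hz).trans ?_
    rw [div_div]
    have : ‖z‖ ≤ ‖z‖ ^ β := by
      simpa using Real.rpow_le_rpow_of_exponent_le hz1 h1.le
    gcongr
    linarith
  · have hint : Integrable fun ξ : ℝ =>
        2 ^ β / Real.cos (β * Real.pi / 4) * (1 + ‖ξ‖) ^ (-β) :=
      (integrable_one_add_norm (by simpa using h1)).const_mul _
    refine hint.mono' ?_ (ae_of_all _ fun ξ => ?_)
    · exact (hcont.comp_continuous (by fun_prop) fun ξ => by simp).aestronglyMeasurable
    · refine (norm_phiSymbol_le h1.le h2 (by simp)).trans ?_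
      have hn : ‖(ξ * Complex.I : ℂ)‖ = ‖ξ‖ := by simp
      rw [hn, Real.rpow_neg (by positivity)]
      have h3 := one_add_rpow_le (norm_nonneg ξ) hβ.le
      have h4 : 0 ≤ ‖ξ‖ ^ β := by positivity
      have h5 : 0 < (1 + ‖ξ‖) ^ β := by positivity
      rw [← div_eq_mul_inv, div_div, div_le_div_iff₀ (by positivity) (by positivity)]
      nlinarith

/-- The cancellation at infinity of `1 / (z (1 + z ^ β))` against `1 / (z (1 + z))`, and at the origin,
leaves a majorant `O(|z|⁻²)` that does not degenerate as `β → 1`. -/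
theorem norm_psiSymbol_le {β : ℝ} (h1 : 1 ≤ β) (h2 : β < 2) {z : ℂ} (hz : 0 ≤ z.re) :
    ‖psiSymbol β z‖ ≤ 8 / Real.cos (β * Real.pi / 4) * (1 + ‖z‖ ^ 2)⁻¹ := by
  have hc := cos_mul_pi_div_four_pos (by linarith) h2
  set c := Real.cos (β * Real.pi / 4)
  set r := ‖z‖ with hr
  have hr0 : 0 ≤ r := norm_nonneg _
  have ha : 0 ≤ r ^ (β - 1) := Real.rpow_nonneg hr0 _
  have hb : 0 ≤ r ^ β := Real.rpow_nonneg hr0 _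
  have hnum : ‖1 - z ^ ((β - 1 : ℝ) : ℂ)‖ ≤ 1 + r ^ (β - 1) := by
    refine (norm_sub_le _ _).trans ?_
    rw [norm_one, Complex.norm_cpow_real]
  have hden1 : (1 + r) / 2 ≤ ‖1 + z‖ := by
    have h3 : r ≤ ‖1 + z‖ := by
      have := norm_le_norm_add_of_re_nonneg hz one_pos
      rwa [Complex.ofReal_one, add_comm] at this
    have h4 := Complex.re_le_norm (1 + z)
    rw [Complex.add_re, Complex.one_re] at h4
    linarith
  have hden2 := le_norm_one_add_cpow (by linarith) h2.le hz
  have hmix : (1 + r ^ (β - 1)) * (1 + r) ≤ 4 * (1 + r ^ β) := by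
    have hmul : r ^ (β - 1) * r ≤ 1 + r ^ β := by
      rcases hr0.eq_or_lt with h | h
      · rw [← h, mul_zero]; rw [← h] at hb; linarith
      · rw [← Real.rpow_add_one h.ne']; simp
    rcases le_total r 1 with h | h
    · have : r ^ (β - 1) ≤ 1 := Real.rpow_le_one hr0 h (by linarith)
      nlinarith
    · have h5 : r ^ (β - 1) ≤ r ^ β := Real.rpow_le_rpow_of_exponent_le h (by linarith)
      have h6 : r ≤ r ^ β := by simpa using Real.rpow_le_rpow_of_exponent_le h h1
      nlinarith
  rw [psiSymbol, norm_div, norm_mul]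
  calc ‖1 - z ^ ((β - 1 : ℝ) : ℂ)‖ / (‖1 + z‖ * ‖1 + z ^ (β : ℂ)‖)
      ≤ (1 + r ^ (β - 1)) / ((1 + r) / 2 * (c * (1 + r ^ β))) :=
        div_le_div₀ (by positivity) hnum (by positivity) (by gcongr)
    _ ≤ _ := by
        rw [← div_eq_mul_inv, div_div, div_le_div_iff₀ (by positivity) (by positivity)]
        have h7 : 1 + r ^ 2 ≤ (1 + r) ^ 2 := by nlinarith
        calc (1 + r ^ (β - 1)) * (c * (1 + r ^ 2))
            ≤ (1 + r ^ (β - 1)) * (c * (1 + r) ^ 2) := by gcongr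
          _ = c * (1 + r) * ((1 + r ^ (β - 1)) * (1 + r)) := by ring
          _ ≤ c * (1 + r) * (4 * (1 + r ^ β)) := by gcongr
          _ = _ := by ring

theorem integrable_psiSymbol_bound (C : ℝ) : Integrable fun ξ : ℝ => C * (1 + ξ ^ 2)⁻¹ :=
  integrable_inv_one_add_sq.const_mul C

theorem psiSymbol_one (z : ℂ) : psiSymbol 1 z = 0 := by simp [psiSymbol]

theorem continuousOn_psiSymbol {β : ℝ} (h1 : 1 ≤ β) (h2 : β < 2) :
    ContinuousOn (psiSymbol β) {z | 0 ≤ z.re} := by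
  -- For `β = 1` the power `z ^ 0` is `1` also at the origin, and the symbol vanishes identically.
  rcases h1.eq_or_lt with rfl | h1
  · exact (continuousOn_const (c := (0 : ℂ))).congr fun z _ => psiSymbol_one z
  exact (continuousOn_const.sub (continuousOn_cpow_rightHalfPlane (by linarith))).div
    ((continuousOn_const.add continuousOn_id).mul
      (continuousOn_const.add (continuousOn_cpow_rightHalfPlane (by linarith))))
    fun z hz => mul_ne_zero (one_add_ne_zero_of_re hz) (one_add_cpow_ne_zero (by linarith) h2 hz)

theorem laplaceInvertible_psiSymbol {β : ℝ} (h1 : 1 ≤ β) (h2 : β < 2) :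
    LaplaceInvertible (psiSymbol β) := by
  have hβ : 0 < β := by linarith
  have hc := cos_mul_pi_div_four_pos hβ.le h2
  have hcont := continuousOn_psiSymbol h1 h2
  refine ⟨hcont, ?_, ⟨8 / Real.cos (β * Real.pi / 4), 1, fun z hz hz1 => ?_⟩, ?_⟩
  · exact ((differentiableOn_const _).sub (differentiableOn_cpow_rightHalfPlane _)).div
      (((differentiableOn_const _).add differentiableOn_id).mul
        ((differentiableOn_const _).add (differentiableOn_cpow_rightHalfPlane β)))
      fun z hz => mul_ne_zero (one_add_ne_zero_of_re (le_of_lt hz))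
        (one_add_cpow_ne_zero hβ h2 (le_of_lt hz))
  · refine (norm_psiSymbol_le h1 h2 hz).trans ?_
    rw [← div_eq_mul_inv]
    gcongr
    nlinarith
  · refine (integrable_psiSymbol_bound (8 / Real.cos (β * Real.pi / 4))).mono' ?_
      (ae_of_all _ fun ξ => ?_)
    · exact (hcont.comp_continuous (by fun_prop) fun ξ => by simp).aestronglyMeasurable
    · simpa using norm_psiSymbol_le h1 h2 (z := ξ * Complex.I) (by simp)

/-- For `re z ≥ 0` and `β ≥ 1` one has `|(z + 2) ^ β| ≥ |z + 2| ≥ 2`, which bounds `1 + (z + 2) ^ β`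
from below uniformly up to `β = 2`, and beyond. -/
theorem norm_add_two_div_two_le {β : ℝ} (h1 : 1 ≤ β) {z : ℂ} (hz : 0 ≤ z.re) :
    ‖z + 2‖ / 2 ≤ ‖1 + (z + 2) ^ (β : ℂ)‖ ∧ 2 ≤ ‖z + 2‖ := by
  have h2 : 2 ≤ ‖z + 2‖ := by
    have := Complex.re_le_norm (z + 2)
    simp at this
    linarith
  refine ⟨?_, h2⟩
  have h3 : ‖z + 2‖ ≤ ‖(z + 2) ^ (β : ℂ)‖ := by
    rw [Complex.norm_cpow_real]
    simpa using Real.rpow_le_rpow_of_exponent_le (by linarith : 1 ≤ ‖z + 2‖) h1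
  have h4 : ‖(z + 2) ^ (β : ℂ)‖ ≤ ‖1 + (z + 2) ^ (β : ℂ)‖ + ‖(1 : ℂ)‖ := by
    simpa using norm_sub_le (1 + (z + 2) ^ (β : ℂ)) 1
  rw [norm_one] at h4
  linarith

theorem norm_shiftedSymbol_le {β : ℝ} (h1 : 1 ≤ β) {z : ℂ} (hz : 0 ≤ z.re) :
    ‖shiftedSymbol β z‖ ≤ 2 * (1 + ‖z‖ ^ 2)⁻¹ := by
  obtain ⟨h2, h3⟩ := norm_add_two_div_two_le h1 hz
  have h4 : 1 + ‖z‖ ^ 2 ≤ ‖z + 2‖ ^ 2 := by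
    rw [Complex.sq_norm, Complex.sq_norm, Complex.normSq_apply, Complex.normSq_apply]
    simp
    nlinarith
  rw [shiftedSymbol, norm_div, norm_one, norm_mul]
  calc 1 / (‖z + 2‖ * ‖1 + (z + 2) ^ (β : ℂ)‖) ≤ 1 / (‖z + 2‖ * (‖z + 2‖ / 2)) := by gcongr
    _ = 2 * (‖z + 2‖ ^ 2)⁻¹ := by field_simp
    _ ≤ _ := by gcongr

theorem shiftedSymbol_den_ne_zero {β : ℝ} (h1 : 1 ≤ β) {z : ℂ} (hz : 0 ≤ z.re) :
    (z + 2) * (1 + (z + 2) ^ (β : ℂ)) ≠ 0 := by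
  obtain ⟨h2, h3⟩ := norm_add_two_div_two_le h1 hz
  exact mul_ne_zero (norm_pos_iff.1 (by linarith)) (norm_pos_iff.1 (by linarith))

theorem laplaceInvertible_shiftedSymbol {β : ℝ} (h1 : 1 ≤ β) :
    LaplaceInvertible (shiftedSymbol β) := by
  have hd : ∀ z : ℂ, 0 ≤ z.re → DifferentiableAt ℂ (shiftedSymbol β) z := fun z hz => by
    have hs : z + 2 ∈ Complex.slitPlane := Complex.mem_slitPlane_iff.2 (Or.inl (by simp; linarith))
    exact (differentiableAt_const _).div ((differentiableAt_id.add_const _).mul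
      ((differentiableAt_const _).add ((differentiableAt_id.add_const _).cpow
        (differentiableAt_const _) hs))) (shiftedSymbol_den_ne_zero h1 hz)
  have hcont : ContinuousOn (shiftedSymbol β) {z | 0 ≤ z.re} := fun z hz =>
    (hd z hz).continuousAt.continuousWithinAt
  refine ⟨hcont, fun z hz => (hd z (le_of_lt hz)).differentiableWithinAt,
    ⟨2, 1, fun z hz hz1 => ?_⟩, ?_⟩
  · refine (norm_shiftedSymbol_le h1 hz).trans ?_
    rw [← div_eq_mul_inv]
    gcongr
    nlinarith
  · refine (integrable_psiSymbol_bound 2).mono' ?_ (ae_of_all _ fun ξ => ?_)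
    · exact (hcont.comp_continuous (by fun_prop) fun ξ => by simp).aestronglyMeasurable
    · simpa using norm_shiftedSymbol_le h1 (z := ξ * Complex.I) (by simp)

theorem phiSymbol_ofReal {β x : ℝ} (hx : 0 < x) : (phiSymbol β x).re = 1 / (1 + x ^ β) := by
  rw [phiSymbol, ← Complex.ofReal_cpow hx.le, ← Complex.ofReal_one, ← Complex.ofReal_add,
    ← Complex.ofReal_div, Complex.ofReal_re]

theorem psiSymbol_ofReal {β x : ℝ} (hx : 0 < x) :
    (psiSymbol β x).re = 1 / (x * (1 + x ^ β)) - (1 / x - 1 / (x + 1)) := by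
  rw [psiSymbol, ← Complex.ofReal_cpow hx.le, ← Complex.ofReal_cpow hx.le]
  norm_cast
  have h1 : 0 < x ^ β := Real.rpow_pos_of_pos hx _
  rw [Real.rpow_sub_one hx.ne']
  field_simp
  ring

theorem shiftedSymbol_ofReal {β x : ℝ} (hx : 0 < x) :
    (shiftedSymbol β x).re = 1 / ((x + 2) * (1 + (x + 2) ^ β)) := by
  have h : ((x : ℂ) + 2) = ((x + 2 : ℝ) : ℂ) := by push_cast; ring
  rw [shiftedSymbol, h, ← Complex.ofReal_cpow (by linarith)]
  norm_cast

/-! ### Continuous dependence of the symbols on `β` -/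

theorem tendsto_integral_norm_psiSymbol_sub {b : ℝ} (hb : b ∈ Ico (1 : ℝ) 2) :
    Tendsto (fun β : ℝ => ∫ ξ : ℝ, ‖psiSymbol β (ξ * Complex.I) - psiSymbol b (ξ * Complex.I)‖)
      (𝓝[Ico 1 2] b) (𝓝 0) := by
  -- The bound on the symbol degenerates at `β = 2`, so it is taken uniform on `[1, d)` only.
  obtain ⟨d, hbd, hd2⟩ := exists_between hb.2
  have hd1 : 1 ≤ d := hb.1.trans hbd.le
  have hcd := cos_mul_pi_div_four_pos (by linarith) hd2
  have hpi := Real.pi_pos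
  have key : ∀ β : ℝ, 1 ≤ β → β < d → ∀ ξ : ℝ, ‖psiSymbol β (ξ * Complex.I)‖ ≤
      8 / Real.cos (d * Real.pi / 4) * (1 + ξ ^ 2)⁻¹ := by
    intro β h1 h2 ξ
    have := norm_psiSymbol_le h1 (h2.trans hd2) (z := ξ * Complex.I) (by simp)
    have hcos : Real.cos (d * Real.pi / 4) ≤ Real.cos (β * Real.pi / 4) :=
      Real.cos_le_cos_of_nonneg_of_le_pi (by positivity) (by nlinarith) (by nlinarith)
    refine this.trans ?_
    simp only [norm_mul, Complex.norm_real, Complex.norm_I, mul_one, Real.norm_eq_abs, sq_abs]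
    gcongr
  have hev : ∀ᶠ β in 𝓝[Ico 1 2] b, β ∈ Ico (1 : ℝ) 2 ∧ β < d :=
    (eventually_mem_nhdsWithin).and (mem_nhdsWithin_of_mem_nhds (Iio_mem_nhds hbd))
  have hlim := tendsto_integral_filter_of_dominated_convergence (μ := (volume : Measure ℝ))
    (F := fun β ξ => ‖psiSymbol β (ξ * Complex.I) - psiSymbol b (ξ * Complex.I)‖)
    (f := fun _ => (0 : ℝ)) (l := 𝓝[Ico 1 2] b)
    (fun ξ => 2 * (8 / Real.cos (d * Real.pi / 4)) * (1 + ξ ^ 2)⁻¹) ?_ ?_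
    (integrable_psiSymbol_bound _) ?_
  · simpa using hlim
  · filter_upwards [hev] with β hβ
    exact ((laplaceInvertible_psiSymbol hβ.1.1 hβ.1.2).integrable.1.sub
      (laplaceInvertible_psiSymbol hb.1 hb.2).integrable.1).norm
  · filter_upwards [hev] with β hβ
    refine ae_of_all _ fun ξ => ?_
    rw [norm_norm]
    refine (norm_sub_le _ _).trans ?_
    linarith [key β hβ.1.1 hβ.2 ξ, key b hb.1 hbd ξ]
  · -- `0 ^ (β - 1)` is discontinuous in `β` at `1`, so the origin is discarded.
    have hne : ∀ᵐ ξ : ℝ, ξ ≠ 0 := by simp [ae_iff]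
    filter_upwards [hne] with ξ hξ
    have hz : (ξ * Complex.I : ℂ) ≠ 0 := by simpa using hξ
    have hcp : ∀ g : ℝ → ℝ, Continuous g →
        Continuous fun β : ℝ => (ξ * Complex.I : ℂ) ^ ((g β : ℝ) : ℂ) := fun g hg =>
      continuous_iff_continuousAt.2 fun β =>
        (continuousAt_const_cpow hz).comp (f := fun β : ℝ => ((g β : ℝ) : ℂ))
          (Continuous.continuousAt (by fun_prop))
    have hc : ContinuousAt (fun β : ℝ => psiSymbol β (ξ * Complex.I)) b :=
      (continuousAt_const.sub (hcp (fun β => β - 1) (by fun_prop)).continuousAt).div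
        (continuousAt_const.mul (continuousAt_const.add (hcp id continuous_id).continuousAt))
        (mul_ne_zero (one_add_ne_zero_of_re (by simp))
          (one_add_cpow_ne_zero (by linarith [hb.1]) hb.2 (by simp)))
    have h0 : Tendsto (fun β : ℝ => ‖psiSymbol β (ξ * Complex.I) - psiSymbol b (ξ * Complex.I)‖)
        (𝓝 b) (𝓝 ‖psiSymbol b (ξ * Complex.I) - psiSymbol b (ξ * Complex.I)‖) :=
      (hc.sub continuousAt_const).norm
    rw [sub_self, norm_zero] at h0
    exact h0.mono_left nhdsWithin_le_nhds

theorem tendsto_integral_norm_shiftedSymbol_sub {b : ℝ} (hb : 1 ≤ b) :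
    Tendsto (fun β : ℝ =>
      ∫ ξ : ℝ, ‖shiftedSymbol β (ξ * Complex.I) - shiftedSymbol b (ξ * Complex.I)‖)
      (𝓝[Ici 1] b) (𝓝 0) := by
  have key : ∀ β : ℝ, 1 ≤ β → ∀ ξ : ℝ, ‖shiftedSymbol β (ξ * Complex.I)‖ ≤
      2 * (1 + ξ ^ 2)⁻¹ := by
    intro β h1 ξ
    simpa using norm_shiftedSymbol_le h1 (z := ξ * Complex.I) (by simp)
  have hlim := tendsto_integral_filter_of_dominated_convergence (μ := (volume : Measure ℝ))
    (F := fun β ξ => ‖shiftedSymbol β (ξ * Complex.I) - shiftedSymbol b (ξ * Complex.I)‖)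
    (f := fun _ => (0 : ℝ)) (l := 𝓝[Ici 1] b)
    (fun ξ => 4 * (1 + ξ ^ 2)⁻¹) ?_ ?_ (integrable_psiSymbol_bound _) ?_
  · simpa using hlim
  · filter_upwards [self_mem_nhdsWithin] with β hβ
    exact ((laplaceInvertible_shiftedSymbol hβ).integrable.1.sub
      (laplaceInvertible_shiftedSymbol hb).integrable.1).norm
  · filter_upwards [self_mem_nhdsWithin] with β hβ
    refine ae_of_all _ fun ξ => ?_
    rw [norm_norm]
    refine (norm_sub_le _ _).trans ?_
    linarith [key β hβ ξ, key b hb ξ]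
  · refine ae_of_all _ fun ξ => ?_
    have hz : (ξ * Complex.I + 2 : ℂ) ≠ 0 := fun h => by
      have := congrArg Complex.re h
      simp at this
    have hc : ContinuousAt (fun β : ℝ => shiftedSymbol β (ξ * Complex.I)) b :=
      continuousAt_const.div (continuousAt_const.mul (continuousAt_const.add
        ((continuousAt_const_cpow hz).comp (f := fun β : ℝ => (β : ℂ))
          Complex.continuous_ofReal.continuousAt)))
        (shiftedSymbol_den_ne_zero hb (by simp))
    have h0 : Tendsto (fun β : ℝ => ‖shiftedSymbol β (ξ * Complex.I) - shiftedSymbol b (ξ * Complex.I)‖)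
        (𝓝 b) (𝓝 ‖shiftedSymbol b (ξ * Complex.I) - shiftedSymbol b (ξ * Complex.I)‖) :=
      (hc.sub continuousAt_const).norm
    rw [sub_self, norm_zero] at h0
    exact h0.mono_left nhdsWithin_le_nhds

/-! ### The functions `φ_β` -/

theorem laplace_exp_neg_mul {a x : ℝ} (hax : 0 < a + x) :
    IntegrableOn (fun t => Real.exp (-(x * t)) * Real.exp (-(a * t))) (Ioi 0) ∧
      ∫ t in Ioi (0 : ℝ), Real.exp (-(x * t)) * Real.exp (-(a * t)) = 1 / (x + a) := by
  have h : ∀ t : ℝ, Real.exp (-(x * t)) * Real.exp (-(a * t)) = Real.exp (-(x + a) * t) :=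
    fun t => by rw [← Real.exp_add]; congr 1; ring
  simp only [h]
  refine ⟨exp_neg_integrableOn_Ioi 0 (by linarith), ?_⟩
  rw [integral_exp_mul_Ioi (by linarith), mul_zero, Real.exp_zero, neg_div_neg_eq]

theorem isLaplaceDensity_exp_neg : IsLaplaceDensity 1 fun t => Real.exp (-t) where
  continuousOn := by fun_prop
  integrableOn x hx := by
    simpa using (laplace_exp_neg_mul (a := 1) (x := x) (by linarith)).1
  integral_eq x hx := by
    rw [Real.rpow_one, add_comm 1 x]
    simpa using (laplace_exp_neg_mul (a := 1) (x := x) (by linarith)).2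

theorem isLaplaceDensity_sin : IsLaplaceDensity 2 Real.sin := by
  have h : ∀ x t : ℝ, Real.exp (-(x * t)) * Real.sin t =
      (Complex.exp ((-x + Complex.I) * t)).im := by
    intro x t
    rw [Complex.exp_im]
    simp
  have hi : ∀ x : ℝ, 0 < x → IntegrableOn (fun t : ℝ => Complex.exp ((-x + Complex.I) * t))
      (Ioi 0) := fun x hx => integrableOn_exp_mul_complex_Ioi (by simpa using hx) 0
  refine ⟨Real.continuous_sin.continuousOn, fun x hx => ?_, fun x hx => ?_⟩
  · simp only [h]
    exact (hi x hx).im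
  · simp only [h]
    have h1 := integral_im (hi x hx)
    simp only [RCLike.im_eq_complex_im] at h1
    rw [h1, integral_exp_mul_complex_Ioi (by simpa using hx)]
    have h2 : ((1 : ℂ) + x ^ 2) ≠ 0 := by
      have : (0 : ℝ) < 1 + x ^ 2 := by positivity
      exact_mod_cast this.ne'
    have h3 : (-x + Complex.I : ℂ) ≠ 0 := fun h => by
      have := congrArg Complex.im h
      simp at this
    have h4 : -Complex.exp ((-x + Complex.I) * (0 : ℝ)) / (-x + Complex.I) =
        ((1 / (1 + x ^ 2) : ℝ) : ℂ) * (x + Complex.I) := by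
      push_cast
      simp only [mul_zero, Complex.exp_zero]
      field_simp
      ring_nf
      simp
      ring
    rw [h4, Complex.im_ofReal_mul]
    simp

/-- For each `β ∈ [1, 2]` the density exists, and it can be chosen bounded. -/
theorem exists_bounded_isLaplaceDensity {β : ℝ} (hβ : β ∈ Icc (1 : ℝ) 2) :
    ∃ f : ℝ → ℝ, IsLaplaceDensity β f ∧ ∃ M : ℝ, ∀ t : ℝ, 0 ≤ t → |f t| ≤ M := by
  rcases hβ.1.eq_or_lt with rfl | h1
  · refine ⟨_, isLaplaceDensity_exp_neg, 1, fun t ht => ?_⟩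
    rw [abs_of_pos (Real.exp_pos _)]
    simpa using ht
  rcases hβ.2.eq_or_lt with rfl | h2
  · exact ⟨_, isLaplaceDensity_sin, 1, fun t _ => Real.abs_sin_le_one t⟩
  have hF := laplaceInvertible_phiSymbol h1 h2
  refine ⟨axisInv (phiSymbol β), ⟨(continuous_axisInv hF.integrable).continuousOn,
    fun x hx => (hF.laplace_axisInv hx).1, fun x hx => ?_⟩, _, fun t _ => abs_axisInv_le _ t⟩
  rw [(hF.laplace_axisInv hx).2, phiSymbol_ofReal hx]

theorem isLaplaceDensity_phi {β : ℝ} (hβ : β ∈ Icc (1 : ℝ) 2) : IsLaplaceDensity β (phi β) :=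
  Classical.epsilon_spec (let ⟨f, hf, _⟩ := exists_bounded_isLaplaceDensity hβ; ⟨f, hf⟩)

theorem IsLaplaceDensity.eqOn {β : ℝ} {f g : ℝ → ℝ} (hf : IsLaplaceDensity β f)
    (hg : IsLaplaceDensity β g) : EqOn f g (Ici 0) :=
  eqOn_of_laplace_eq hf.continuousOn hg.continuousOn hf.integrableOn hg.integrableOn
    fun x hx => by rw [hf.integral_eq x hx, hg.integral_eq x hx]

theorem exists_abs_phi_le {β : ℝ} (hβ : β ∈ Icc (1 : ℝ) 2) :
    ∃ M : ℝ, ∀ t : ℝ, 0 ≤ t → |phi β t| ≤ M := by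
  obtain ⟨f, hf, M, hM⟩ := exists_bounded_isLaplaceDensity hβ
  exact ⟨M, fun t ht => by rw [(isLaplaceDensity_phi hβ).eqOn hf ht]; exact hM t ht⟩

/-! ### The functions `ψ_β` -/

theorem psi_one {t : ℝ} (ht : 0 ≤ t) : psi 1 t = 1 - Real.exp (-t) := by
  have h : psi 1 t = ∫ s in (0 : ℝ)..t, Real.exp (-s) :=
    intervalIntegral.integral_congr fun s hs =>
      (isLaplaceDensity_phi (by norm_num)).eqOn isLaplaceDensity_exp_neg
        (by rw [uIcc_of_le ht] at hs; exact hs.1)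
  rw [h, intervalIntegral.integral_comp_neg Real.exp, integral_exp]
  simp

theorem psi_two {t : ℝ} (ht : 0 ≤ t) : psi 2 t = 1 - Real.cos t := by
  have h : psi 2 t = ∫ s in (0 : ℝ)..t, Real.sin s :=
    intervalIntegral.integral_congr fun s hs =>
      (isLaplaceDensity_phi (by norm_num)).eqOn isLaplaceDensity_sin
        (by rw [uIcc_of_le ht] at hs; exact hs.1)
  rw [h, integral_sin, Real.cos_zero]

theorem exists_abs_psi_sub_le {β : ℝ} (hβ : β ∈ Icc (1 : ℝ) 2) :
    ∃ M : ℝ, 0 ≤ M ∧ ∀ s t : ℝ, 0 ≤ s → 0 ≤ t → |psi β t - psi β s| ≤ M * |t - s| := by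
  obtain ⟨M, hM⟩ := exists_abs_phi_le hβ
  have hint : ∀ a b : ℝ, 0 ≤ a → 0 ≤ b → IntervalIntegrable (phi β) volume a b := fun a b ha hb =>
    ((isLaplaceDensity_phi hβ).continuousOn.mono fun x hx =>
      (le_min ha hb).trans hx.1).intervalIntegrable
  refine ⟨M, (abs_nonneg _).trans (hM 0 le_rfl), fun s t hs ht => ?_⟩
  rw [psi, psi, intervalIntegral.integral_interval_sub_left (hint 0 t le_rfl ht)
    (hint 0 s le_rfl hs)]
  rw [← Real.norm_eq_abs]
  refine intervalIntegral.norm_integral_le_of_norm_le_const (C := M) fun x hx => ?_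
  rw [Real.norm_eq_abs]
  refine hM x ?_
  rw [uIoc, mem_Ioc] at hx
  exact (le_min hs ht).trans hx.1.le

theorem continuousOn_psi {β : ℝ} (hβ : β ∈ Icc (1 : ℝ) 2) : ContinuousOn (psi β) (Ici 0) := by
  obtain ⟨M, hM, h⟩ := exists_abs_psi_sub_le hβ
  refine LipschitzOnWith.continuousOn (K := ⟨M, hM⟩) (LipschitzOnWith.of_dist_le_mul ?_)
  intro t ht s hs
  exact h s t hs ht

/-- Integration by parts, using that `ψ_β` grows at most linearly. -/
theorem laplace_psi {β : ℝ} (hβ : β ∈ Icc (1 : ℝ) 2) {x : ℝ} (hx : 0 < x) :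
    IntegrableOn (fun t => Real.exp (-(x * t)) * psi β t) (Ioi 0) ∧
      ∫ t in Ioi (0 : ℝ), Real.exp (-(x * t)) * psi β t = 1 / (x * (1 + x ^ β)) := by
  have hφ := isLaplaceDensity_phi hβ
  obtain ⟨M, hM0, hM⟩ := exists_abs_psi_sub_le hβ
  have hψ0 : psi β 0 = 0 := by simp [psi]
  have hlin : ∀ t : ℝ, 0 ≤ t → |psi β t| ≤ M * t := fun t ht => by
    simpa [hψ0, abs_of_nonneg ht] using hM 0 t le_rfl ht
  have hcont := continuousOn_psi hβ
  have hmaj : IntegrableOn (fun t : ℝ => M * (t * Real.exp (-(x * t)))) (Ioi 0) := by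
    have := integrableOn_rpow_mul_exp_neg_mul_rpow (p := 1) (s := 1) (b := x)
      (by norm_num) one_pos hx
    rw [IntegrableOn]
    simpa using this.const_mul M
  have hint : IntegrableOn (fun t => Real.exp (-(x * t)) * psi β t) (Ioi 0) := by
    refine Integrable.mono' hmaj ?_ ?_
    · exact ((ContinuousOn.mul (by fun_prop) hcont).mono
        Ioi_subset_Ici_self).aestronglyMeasurable measurableSet_Ioi
    · filter_upwards [ae_restrict_mem measurableSet_Ioi] with t ht
      rw [norm_mul, Real.norm_of_nonneg (Real.exp_pos _).le]
      calc _ ≤ Real.exp (-(x * t)) * (M * t) := by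
            gcongr; exact hlin t (le_of_lt ht)
        _ = _ := by ring
  refine ⟨hint, ?_⟩
  have hderiv : ∀ t ∈ Ioi (0 : ℝ), HasDerivAt (fun t => Real.exp (-(x * t)) * psi β t)
      (Real.exp (-(x * t)) * phi β t - x * (Real.exp (-(x * t)) * psi β t)) t := by
    intro t ht
    have h1 : HasDerivAt (fun t => Real.exp (-(x * t))) (Real.exp (-(x * t)) * -(x * 1)) t :=
      ((hasDerivAt_id t).const_mul x).neg.exp
    have hca : ContinuousAt (phi β) t :=
      (hφ.continuousOn).continuousAt (Ici_mem_nhds ht)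
    have h2 : HasDerivAt (psi β) (phi β t) t := by
      refine intervalIntegral.integral_hasDerivAt_right ?_ ?_ hca
      · exact (hφ.continuousOn.mono fun s hs => by
          rw [uIcc_of_le (le_of_lt ht)] at hs; exact hs.1).intervalIntegrable
      · exact (hφ.continuousOn.mono Ioi_subset_Ici_self).stronglyMeasurableAtFilter isOpen_Ioi t ht
    convert! h1.mul h2 using 1
    ring
  have hlim : Tendsto (fun t => Real.exp (-(x * t)) * psi β t) atTop (𝓝 0) := by
    have h1 : Tendsto (fun t : ℝ => M * (t ^ (1 : ℝ) * Real.exp (-x * t))) atTop (𝓝 0) := by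
      simpa using (tendsto_rpow_mul_exp_neg_mul_atTop_nhds_zero 1 x hx).const_mul M
    refine squeeze_zero_norm' ?_ h1
    filter_upwards [eventually_ge_atTop 0] with t ht
    rw [norm_mul, Real.norm_of_nonneg (Real.exp_pos _).le, Real.rpow_one, neg_mul]
    calc _ ≤ Real.exp (-(x * t)) * (M * t) := by gcongr; exact hlin t ht
      _ = _ := by ring
  have hφi := hφ.integrableOn x hx
  have hparts := integral_Ioi_of_hasDerivAt_of_tendsto
    (f := fun t => Real.exp (-(x * t)) * psi β t)
    ((ContinuousOn.mul (by fun_prop) hcont) 0 self_mem_Ici) hderiv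
    (hφi.sub (hint.const_mul x)) hlim
  rw [integral_sub hφi (hint.const_mul x), integral_const_mul, hφ.integral_eq x hx, hψ0, mul_zero,
    sub_zero, sub_eq_zero] at hparts
  rw [mul_comm x, ← div_div, hparts]
  field_simp

/-- On `[1, 2)` the whole `β`-dependence of `ψ_β` is carried by an inverse transform along the
imaginary axis of a symbol that is integrable locally uniformly in `β`, up to `β = 1`. -/
theorem psi_eq_add_axisInv {β : ℝ} (hβ : β ∈ Ico (1 : ℝ) 2) {t : ℝ} (ht : 0 ≤ t) :
    psi β t = 1 - Real.exp (-t) + axisInv (psiSymbol β) t := by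
  have hβ' := Ico_subset_Icc_self hβ
  have hF := laplaceInvertible_psiSymbol hβ.1 hβ.2
  have hone : ∀ x : ℝ, 0 < x → IntegrableOn (fun t => Real.exp (-(x * t))) (Ioi 0) ∧
      ∫ t in Ioi (0 : ℝ), Real.exp (-(x * t)) = 1 / x := fun x hx => by
    simpa using laplace_exp_neg_mul (a := 0) (x := x) (by linarith)
  have hexp : ∀ x : ℝ, 0 < x →
      IntegrableOn (fun t => Real.exp (-(x * t)) * Real.exp (-t)) (Ioi 0) ∧
      ∫ t in Ioi (0 : ℝ), Real.exp (-(x * t)) * Real.exp (-t) = 1 / (x + 1) := fun x hx => by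
    simpa using laplace_exp_neg_mul (a := 1) (x := x) (by linarith)
  have hsplit : ∀ x t : ℝ,
      Real.exp (-(x * t)) * (1 - Real.exp (-t) + axisInv (psiSymbol β) t) =
      Real.exp (-(x * t)) - Real.exp (-(x * t)) * Real.exp (-t) +
        Real.exp (-(x * t)) * axisInv (psiSymbol β) t := fun x t => by ring
  refine eqOn_of_laplace_eq (g := fun t => 1 - Real.exp (-t) + axisInv (psiSymbol β) t)
    (continuousOn_psi hβ') ?_ (fun x hx => (laplace_psi hβ' hx).1) ?_ ?_ ht
  · have := continuous_axisInv hF.integrable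
    fun_prop
  · intro x hx
    simp only [hsplit]
    exact ((hone x hx).1.sub (hexp x hx).1).add (hF.laplace_axisInv hx).1
  · intro x hx
    simp only [hsplit]
    have hadd := integral_add ((hone x hx).1.sub (hexp x hx).1) (hF.laplace_axisInv hx).1
    simp only [Pi.sub_apply] at hadd
    rw [(laplace_psi hβ' hx).2, hadd, integral_sub (hone x hx).1 (hexp x hx).1, (hone x hx).2,
      (hexp x hx).2, (hF.laplace_axisInv hx).2, psiSymbol_ofReal hx]
    ring

/-- Inversion along the line `re z = 2`, where the symbols remain controlled up to `β = 2`; the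
price is the factor `e^{2t}`. -/
theorem psi_eq_exp_mul_axisInv {β : ℝ} (hβ : β ∈ Icc (1 : ℝ) 2) {t : ℝ} (ht : 0 ≤ t) :
    psi β t = Real.exp (2 * t) * axisInv (shiftedSymbol β) t := by
  have hF := laplaceInvertible_shiftedSymbol hβ.1
  have hmul : ∀ x t : ℝ, Real.exp (-(x * t)) * (Real.exp (-(2 * t)) * psi β t) =
      Real.exp (-((x + 2) * t)) * psi β t := fun x t => by
    rw [← mul_assoc, ← Real.exp_add]; congr 2; ring
  have h : Real.exp (-(2 * t)) * psi β t = axisInv (shiftedSymbol β) t := by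
    refine eqOn_of_laplace_eq (f := fun t => Real.exp (-(2 * t)) * psi β t)
      (ContinuousOn.mul (by fun_prop) (continuousOn_psi hβ))
      (continuous_axisInv hF.integrable).continuousOn ?_
      (fun x hx => (hF.laplace_axisInv hx).1) ?_ ht
    · intro x hx
      simp only [hmul]
      exact (laplace_psi hβ (by linarith)).1
    · intro x hx
      simp only [hmul]
      rw [(laplace_psi hβ (by linarith)).2, (hF.laplace_axisInv hx).2, shiftedSymbol_ofReal hx]
  rw [← h, ← mul_assoc, ← Real.exp_add]
  simp

theorem abs_psi_sub_psi_le {β b : ℝ} (hβ : β ∈ Ico (1 : ℝ) 2) (hb : b ∈ Ico (1 : ℝ) 2) {t : ℝ}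
    (ht : 0 ≤ t) : |psi β t - psi b t| ≤ (2 * Real.pi)⁻¹ *
      ∫ ξ : ℝ, ‖psiSymbol β (ξ * Complex.I) - psiSymbol b (ξ * Complex.I)‖ := by
  rw [psi_eq_add_axisInv hβ ht, psi_eq_add_axisInv hb ht, add_sub_add_left_eq_sub,
    axisInv_sub (laplaceInvertible_psiSymbol hβ.1 hβ.2).integrable
      (laplaceInvertible_psiSymbol hb.1 hb.2).integrable]
  exact abs_axisInv_le _ t

/-- `ψ_β`, for `1 ≤ β < 2`, as a bounded uniformly continuous function. -/
theorem exists_psi_mem_UCB {β : ℝ} (hβ : β ∈ Ico (1 : ℝ) 2) :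
    ∃ f : UCB, ∀ t : ℝ≥0, (f : ℝ≥0 →ᵇ ℝ) t = psi β t := by
  have hβ' := Ico_subset_Icc_self hβ
  obtain ⟨M, hM0, hM⟩ := exists_abs_psi_sub_le hβ'
  have huc : UniformContinuous fun t : ℝ≥0 => psi β t :=
    (LipschitzWith.of_dist_le_mul (K := ⟨M, hM0⟩)
      fun s t : ℝ≥0 => hM t s t.coe_nonneg s.coe_nonneg).uniformContinuous
  have hbd : ∀ t : ℝ≥0, ‖psi β t‖ ≤
      2 + (2 * Real.pi)⁻¹ * ∫ ξ : ℝ, ‖psiSymbol β (ξ * Complex.I)‖ := fun t => by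
    rw [psi_eq_add_axisInv hβ t.coe_nonneg]
    refine (norm_add_le _ _).trans (add_le_add ?_ (abs_axisInv_le _ _))
    have h1 : Real.exp (-(t : ℝ)) ≤ 1 := by simp
    have h2 := Real.exp_pos (-(t : ℝ))
    rw [Real.norm_eq_abs, abs_le]
    constructor <;> linarith
  exact ⟨⟨BoundedContinuousFunction.ofNormedAddCommGroup _ huc.continuous _ hbd, huc⟩,
    fun t => rfl⟩

theorem continuous_of_forall_eq_psi {Ψ : Ico (1 : ℝ) 2 → UCB}
    (hΨ : ∀ (β : Ico (1 : ℝ) 2) (t : ℝ≥0), (Ψ β : ℝ≥0 →ᵇ ℝ) t = psi β t) : Continuous Ψ := by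
  refine continuous_iff_continuousAt.2 fun b => ?_
  rw [ContinuousAt, tendsto_iff_dist_tendsto_zero]
  have hval : Tendsto (fun β : Ico (1 : ℝ) 2 => (β : ℝ)) (𝓝 b) (𝓝[Ico 1 2] (b : ℝ)) :=
    tendsto_nhdsWithin_iff.2 ⟨continuous_subtype_val.tendsto b, Eventually.of_forall fun β => β.2⟩
  have hlim := ((tendsto_integral_norm_psiSymbol_sub b.2).comp hval).const_mul (2 * Real.pi)⁻¹
  rw [mul_zero] at hlim
  refine squeeze_zero (fun _ => dist_nonneg) (fun β => ?_) hlim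
  refine (BoundedContinuousFunction.dist_le
    (mul_nonneg (by positivity) (integral_nonneg fun _ => norm_nonneg _))).2 fun t => ?_
  rw [hΨ, hΨ]
  exact abs_psi_sub_psi_le β.2 b.2 t.coe_nonneg

theorem tendstoLocallyUniformlyOn_psi :
    TendstoLocallyUniformlyOn psi (psi 2) (𝓝[<] 2) (Ici 0) := by
  rw [Metric.tendstoLocallyUniformlyOn_iff]
  intro ε hε t₀ _
  -- On this neighbourhood of `t₀` the factor `e^{2t}` is at most `e^{2(t₀ + 1)}`.
  refine ⟨Iio (t₀ + 1) ∩ Ici 0,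
    inter_mem (mem_nhdsWithin_of_mem_nhds (Iio_mem_nhds (by linarith))) self_mem_nhdsWithin, ?_⟩
  have hIcc : ∀ᶠ β in 𝓝[<] (2 : ℝ), β ∈ Icc (1 : ℝ) 2 := by
    filter_upwards [Ioo_mem_nhdsLT (show (1 : ℝ) < 2 by norm_num)] with β hβ
    exact Ioo_subset_Icc_self hβ
  have hle : Tendsto id (𝓝[<] (2 : ℝ)) (𝓝[Ici 1] 2) :=
    tendsto_nhdsWithin_iff.2 ⟨tendsto_id.mono_right nhdsWithin_le_nhds, hIcc.mono fun _ h => h.1⟩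
  have hlim := ((tendsto_integral_norm_shiftedSymbol_sub one_le_two).comp hle).const_mul
    (Real.exp (2 * (t₀ + 1)) * (2 * Real.pi)⁻¹)
  rw [mul_zero] at hlim
  filter_upwards [hIcc, hlim.eventually (gt_mem_nhds hε)] with β hβ hlt t ht
  have ht0 : 0 ≤ t := ht.2
  have ht1 : t < t₀ + 1 := ht.1
  rw [dist_comm, Real.dist_eq, psi_eq_exp_mul_axisInv hβ ht0,
    psi_eq_exp_mul_axisInv (right_mem_Icc.2 one_le_two) ht0, ← mul_sub,
    axisInv_sub (laplaceInvertible_shiftedSymbol hβ.1).integrable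
      (laplaceInvertible_shiftedSymbol one_le_two).integrable, abs_mul,
    abs_of_pos (Real.exp_pos _)]
  refine lt_of_le_of_lt ?_ hlt
  rw [mul_assoc]
  exact mul_le_mul (Real.exp_le_exp.2 (by linarith)) (abs_axisInv_le _ t) (abs_nonneg _)
    (Real.exp_pos _).le

theorem theorem7 :
    -- the functions `φ_β`, `1 ≤ β ≤ 2`, are well defined
    (∀ β ∈ Icc (1 : ℝ) 2, IsLaplaceDensity β (phi β) ∧
      ∀ f : ℝ → ℝ, IsLaplaceDensity β f → EqOn f (phi β) (Ici 0)) ∧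
    -- `ψ_β` as an element of the Banach space `UCB`, for `1 ≤ β < 2`
    (∃ Ψ : Ico (1 : ℝ) 2 → UCB,
      (∀ (β : Ico (1 : ℝ) 2) (t : ℝ≥0), (Ψ β : ℝ≥0 →ᵇ ℝ) t = psi β t) ∧
      ContinuousOn Ψ {β | (1 : ℝ) < β} ∧
      Tendsto Ψ (𝓝[>] ⟨1, by norm_num⟩) (𝓝 (Ψ ⟨1, by norm_num⟩))) ∧
    (∀ t : ℝ, 0 ≤ t → psi 1 t = 1 - Real.exp (-t)) ∧
    TendstoLocallyUniformlyOn psi (psi 2) (𝓝[<] 2) (Ici 0) ∧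
    (∀ t : ℝ, 0 ≤ t → psi 2 t = 1 - Real.cos t) := by
  choose Ψ hΨ using fun β : Ico (1 : ℝ) 2 => exists_psi_mem_UCB β.2
  have hcont := continuous_of_forall_eq_psi hΨ
  exact ⟨fun β hβ => ⟨isLaplaceDensity_phi hβ, fun f hf => hf.eqOn (isLaplaceDensity_phi hβ)⟩,
    ⟨Ψ, hΨ, hcont.continuousOn, hcont.continuousAt.mono_left nhdsWithin_le_nhds⟩,
    fun t ht => psi_one ht, tendstoLocallyUniformlyOn_psi, fun t ht => psi_two ht⟩
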